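/- Let $M_1\ge M_2\ge M_3$ be natural numbers with $M_1<M_2+M_3$. Consider the 3-user MIMO interference channel in which transmitter $i$ and receiver $i$ have $M_i$ antennas each: $$Y_i=\sum_{k=1}^{3}H_{ik}X_k+Z_i\in\mathbb C^{M_i},\qquad i=1,2,3,$$ where $H_{ik}\in\mathbb C^{M_i\times M_k}$ are fixed channel matrices, the noises $Z_i\sim\mathcal{CN}(0,I_{M_i})$ are independent over receivers and channel uses, and each input $X_i\in\mathbb C^{M_i}$ obeys the average power constraint $\mathbb E\|X_i\|^2\le P$ (the average being over the block and the uniformly distributed message). Transmitter $i$ has an independent message, uniform on $2^{\lceil nR_i\rceil}$ values, for receiver $i$; a rate vector $(R_1,R_2,R_3)\in[0,\infty)^3$ is achievable at power $P$ if there is a sequence of codes of block length $n$ obeying the power constraint for which the probability that some receiver decodes its message wrongly tends to $0$ as $n\to\infty$. The sum degrees of freedom are $$d_\Sigma:=\sup\sum_{i=1}^{3}d_i,\qquad d_i:=\lim_{P\to\infty}\frac{R_i(P)}{\log_2 P},$$ where the supremum is over all families of rate vectors $(R_1(P),R_2(P),R_3(P))_{P>0}$, achievable at power $P$ for every $P>0$,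 for which these limits exist in $[0,\infty]$. Then, for Lebesgue-almost every tuple $(H_{ik})_{1\le i,k\le 3}$ of channel matrices (hence almost surely when the channel coefficients are drawn from any absolutely continuous joint distribution), $$d_\Sigma\le\frac{M_1+M_2+M_3}{2}.$$ -/

import Mathlib

open MeasureTheory ProbabilityTheory Filter Topology
open scoped NNReal ENNReal Matrix

noncomputable section

namespace MIMOIC

/-- The tuple of all channel matrices of a `K`-user MIMO interference channel in which
transmitter `i` and receiver `i` both have `M i` antennas: `H i k` holds the entries of the
`M i × M k` complex matrix from transmitter `k` to receiver `i`. As a product of copies of `ℂ`,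
this space carries Lebesgue measure `volume`. -/
abbrev ChannelGains {K : ℕ} (M : Fin K → ℕ) : Type :=
  ∀ i k : Fin K, Fin (M i) → Fin (M k) → ℂ

/-- The standard circularly symmetric complex Gaussian law (mean `0`, `E|Z|² = 1`): real and
imaginary parts are independent real Gaussians of variance `1 / 2`. -/
def stdComplexGaussian : Measure ℂ :=
  ((gaussianReal 0 (1 / 2)).prod (gaussianReal 0 (1 / 2))).map
    (fun p : ℝ × ℝ => (⟨p.1, p.2⟩ : ℂ))

/-- Law of the noise over `n` channel uses: the entries, indexed by receiver, time and antenna,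
are i.i.d. standard complex Gaussians. -/
def noiseLaw {K : ℕ} (M : Fin K → ℕ) (n : ℕ) :
    Measure (∀ i : Fin K, Fin n → Fin (M i) → ℂ) :=
  Measure.pi fun i => Measure.pi fun _ : Fin n => Measure.pi fun _ : Fin (M i) =>
    stdComplexGaussian

/-- A block code of length `n` and rates `R` (in bits per channel use), under the power
constraint `P`. User `i` has the message set `{0, …, 2 ^ ⌈n R i⌉ - 1}`. -/
structure Code {K : ℕ} (M : Fin K → ℕ) (n : ℕ) (R : Fin K → ℝ≥0) (P : ℝ) where
  /-- The codeword of each message: for each time, the symbols sent by the antennas. -/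
  enc : ∀ i : Fin K, Fin (2 ^ ⌈(n : ℝ) * (R i : ℝ)⌉₊) → Fin n → Fin (M i) → ℂ
  /-- The message that receiver `i` declares, as a function of its own output block. -/
  dec : ∀ i : Fin K, (Fin n → Fin (M i) → ℂ) → Fin (2 ^ ⌈(n : ℝ) * (R i : ℝ)⌉₊)
  measurable_dec : ∀ i, Measurable (dec i)
  /-- The average over the block and over a uniform message of the transmitted power
  `‖x‖² = ∑ a, |x a|²` is at most `P`. -/
  power : ∀ i, (∑ w, ∑ t, ∑ a, ‖enc i w t a‖ ^ 2) / 2 ^ ⌈(n : ℝ) * (R i : ℝ)⌉₊ ≤ n * P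

namespace Code

variable {K : ℕ} {M : Fin K → ℕ} {n : ℕ} {R : Fin K → ℝ≥0} {P : ℝ}

/-- The output block at receiver `i`: `Y i t = ∑ k, H i k * X k t + Z i t` when the messages are
`w` and the noise is `z`. -/
def output (C : Code M n R P) (H : ChannelGains M)
    (w : ∀ i : Fin K, Fin (2 ^ ⌈(n : ℝ) * (R i : ℝ)⌉₊))
    (z : ∀ i : Fin K, Fin n → Fin (M i) → ℂ) (i : Fin K) : Fin n → Fin (M i) → ℂ :=
  fun t => (∑ k, Matrix.of (H i k) *ᵥ C.enc k (w k) t) + z i t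

/-- The probability that at least one receiver decodes its message wrongly, when the messages are
independent and uniform, and independent of the noise. -/
def errorProb (C : Code M n R P) (H : ChannelGains M) : ℝ :=
  (∑ w : ∀ i : Fin K, Fin (2 ^ ⌈(n : ℝ) * (R i : ℝ)⌉₊),
      (noiseLaw M n).real {z | ∃ i, C.dec i (C.output H w z i) ≠ w i}) /
    Fintype.card (∀ i : Fin K, Fin (2 ^ ⌈(n : ℝ) * (R i : ℝ)⌉₊))

end Code

/-- The rate vector `R` is achievable at power `P` over the channel `H`. -/
def Achievable {K : ℕ} {M : Fin K → ℕ} (H : ChannelGains M) (P : ℝ) (R : Fin K → ℝ≥0) : Prop :=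
  ∃ C : ∀ n : ℕ, Code M n R P, Tendsto (fun n => (C n).errorProb H) atTop (𝓝 0)

/-- The sum degrees of freedom: the supremum of `∑ i, d i` over all families of achievable rate
vectors `R P`, `P > 0`, for which all limits `d i = lim R P i / log P` exist in `[0, ∞]`. -/
def sumDoF {K : ℕ} {M : Fin K → ℕ} (H : ChannelGains M) : ℝ≥0∞ :=
  sSup {s | ∃ (R : ℝ → Fin K → ℝ≥0) (d : Fin K → ℝ≥0∞),
    (∀ P : ℝ, 0 < P → Achievable H P (R P)) ∧
    (∀ i, Tendsto (fun P : ℝ => ENNReal.ofReal ((R P i : ℝ) / Real.logb 2 P)) atTop (𝓝 (d i))) ∧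
    s = ∑ i, d i}

end MIMOIC

end

/-! Let `B` be the full gain matrix `H` with its diagonal blocks set to zero. For almost every `H`
the matrix `B` is invertible, and `A = H B⁻¹` recovers the noiseless outputs from the noiseless
interference. Put `Y = HX + Z` and `S = BX + Z'`, with independent noises. In entropy language,
receiver `i` gives `n R_i ≲ h(Y_i) - h(S_i)`, while decoding all messages from the pair `(Y, S)`
gives `n ∑ R_i ≲ ∑ h(S_i) + h(Z - A Z') - h(Z) - h(Z')`. On adding, the `h(S_i)` cancel, and `2 n ∑
R_i ≤ n (∑ M_i) log P + O(n)` remains.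

The argument is carried out in one-shot form: each entropy inequality becomes a pointwise comparison
of densities that fails only with small probability (`sum_withDensity_correct_le`). `exists_typical`
finds messages and noises for which all comparisons hold at once, and `card_sq_le` multiplies them,
so that the unknown interference densities drop out.

Generic invertibility of `B` needs a single witness: since the largest block is no larger than the
other two together, some permutation moves every antenna to another user (`exists_perm_ne_fst`), and
its matrix has zero diagonal blocks. -/

namespace MeasureTheory

/-! ### Densities of finite product measures. -/

theorem lintegral_fin_prod_eq_prod {n : ℕ} {E : Fin n → Type*}
    {mE : ∀ i, MeasurableSpace (E i)} {μ : (i : Fin n) → Measure (E i)} [∀ i, SigmaFinite (μ i)]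
    {f : (i : Fin n) → E i → ℝ≥0∞} (hf : ∀ i, Measurable (f i)) :
    ∫⁻ x : (i : Fin n) → E i, ∏ i, f i (x i) ∂(Measure.pi μ) = ∏ i, ∫⁻ x, f i x ∂(μ i) := by
  induction n with
  | zero => simp
  | succ n ih =>
    have hm : Measurable fun x : E 0 × ((i : Fin n) → E (Fin.succAbove 0 i)) =>
        f 0 x.1 * ∏ i : Fin n, f (Fin.succAbove 0 i) (x.2 i) := by
      refine ((hf 0).comp measurable_fst).mul (Finset.measurable_prod _ fun i _ => ?_)
      exact (hf _).comp ((measurable_pi_apply i).comp measurable_snd)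
    have hm' : Measurable fun x : (i : Fin n) → E (Fin.succAbove 0 i) =>
        ∏ i : Fin n, f (Fin.succAbove 0 i) (x i) :=
      Finset.measurable_prod _ fun i _ => (hf _).comp (measurable_pi_apply i)
    rw [Fin.prod_univ_succAbove _ 0, ← ih fun i => hf (Fin.succAbove 0 i),
      ← lintegral_prod_mul (hf 0).aemeasurable hm'.aemeasurable,
      ← (measurePreserving_piFinSuccAbove μ 0).lintegral_comp hm]
    exact lintegral_congr fun x => Fin.prod_univ_succAbove _ 0

theorem pi_withDensity_fin {n : ℕ} {E : Fin n → Type*}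
    {mE : ∀ i, MeasurableSpace (E i)} {μ : (i : Fin n) → Measure (E i)} [∀ i, SigmaFinite (μ i)]
    {f : (i : Fin n) → E i → ℝ≥0∞} (hf : ∀ i, Measurable (f i)) (hfin : ∀ i x, f i x ≠ ∞) :
    Measure.pi (fun i => (μ i).withDensity (f i)) =
      (Measure.pi μ).withDensity (fun x => ∏ i, f i (x i)) := by
  have hsf : ∀ i, SigmaFinite ((μ i).withDensity (f i)) :=
    fun i => SigmaFinite.withDensity_of_ne_top (ae_of_all _ (hfin i))
  refine Measure.pi_eq fun s hs => ?_
  rw [withDensity_apply _ (MeasurableSet.univ_pi hs), Measure.restrict_pi_pi,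
    lintegral_fin_prod_eq_prod hf]
  exact Finset.prod_congr rfl fun i _ => (withDensity_apply _ (hs i)).symm

end MeasureTheory

/-! ### Complex Gaussian densities of blocks. -/

noncomputable section

namespace MIMOIC

/-- The density of a circularly symmetric complex Gaussian variable with `E|Z|² = r`. -/
def complexGaussianPDF (r : ℝ≥0) (z : ℂ) : ℝ≥0∞ :=
  ENNReal.ofReal ((Real.pi * r)⁻¹ * Real.exp (-‖z‖ ^ 2 / r))

lemma measurable_complexGaussianPDF (r : ℝ≥0) : Measurable (complexGaussianPDF r) := by
  unfold complexGaussianPDF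
  fun_prop

lemma map_gaussianReal_prod_eq_withDensity {r : ℝ≥0} (hr : r ≠ 0) :
    ((gaussianReal 0 (r / 2)).prod (gaussianReal 0 (r / 2))).map
      (fun p : ℝ × ℝ => (⟨p.1, p.2⟩ : ℂ)) = volume.withDensity (complexGaussianPDF r) := by
  have h2 : r / 2 ≠ 0 := by positivity
  rw [gaussianReal_of_var_ne_zero _ h2,
    prod_withDensity (measurable_gaussianPDF _ _) (measurable_gaussianPDF _ _)]
  have hmp := Complex.volume_preserving_equiv_real_prod.symm
  have hfun : (fun p : ℝ × ℝ => (⟨p.1, p.2⟩ : ℂ)) = Complex.measurableEquivRealProd.symm := rfl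
  rw [hfun]
  ext s hs
  rw [MeasurableEquiv.map_apply, withDensity_apply _ (hmp.measurable hs), withDensity_apply _ hs,
    ← hmp.setLIntegral_comp_preimage hs (measurable_complexGaussianPDF r),
    ← Measure.volume_eq_prod]
  have key (p : ℝ × ℝ) : gaussianPDF 0 (r / 2) p.1 * gaussianPDF 0 (r / 2) p.2 =
      complexGaussianPDF r (Complex.measurableEquivRealProd.symm p) := by
    rw [gaussianPDF, gaussianPDF, ← ENNReal.ofReal_mul (gaussianPDFReal_nonneg _ _ _),
      complexGaussianPDF]
    congr 1
    have hr' : (0 : ℝ) < r := by positivity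
    simp only [gaussianPDFReal_def, Complex.measurableEquivRealProd_symm_apply, sub_zero]
    have h1 : (2 * Real.pi * ((r / 2 : ℝ≥0) : ℝ)) = Real.pi * r := by push_cast; ring
    have h3 : (2 * ((r / 2 : ℝ≥0) : ℝ)) = r := by push_cast; ring
    rw [h1, h3, Complex.sq_norm, Complex.normSq_mk, mul_mul_mul_comm, ← Real.exp_add, ← mul_inv,
      Real.mul_self_sqrt (by positivity)]
    congr 2
    ring
  simp_rw [key]

lemma stdComplexGaussian_eq_withDensity :
    stdComplexGaussian = volume.withDensity (complexGaussianPDF 1) :=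
  map_gaussianReal_prod_eq_withDensity one_ne_zero

lemma lintegral_complexGaussianPDF {r : ℝ≥0} (hr : r ≠ 0) : ∫⁻ z, complexGaussianPDF r z = 1 := by
  rw [← setLIntegral_univ, ← withDensity_apply _ MeasurableSet.univ,
    ← map_gaussianReal_prod_eq_withDensity hr]
  exact (Measure.isProbabilityMeasure_map
    Complex.measurableEquivRealProd.symm.measurable.aemeasurable).measure_univ

/-- The energy of a block of `n` symbols on `m` antennas. -/
def energy {n m : ℕ} (y : Fin n → Fin m → ℂ) : ℝ := ∑ t, ∑ a, ‖y t a‖ ^ 2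

/-- The density of a block of i.i.d. complex Gaussian symbols of power `r`. -/
def blockPDF {n m : ℕ} (r : ℝ≥0) (y : Fin n → Fin m → ℂ) : ℝ≥0∞ :=
  ∏ t, ∏ a, complexGaussianPDF r (y t a)

variable {n m : ℕ} {r : ℝ≥0}

lemma energy_nonneg (y : Fin n → Fin m → ℂ) : 0 ≤ energy y := by
  unfold energy; positivity

lemma blockPDF_eq (y : Fin n → Fin m → ℂ) :
    blockPDF r y = ENNReal.ofReal ((Real.pi * r)⁻¹ ^ (n * m) * Real.exp (-energy y / r)) := by
  have h (t : Fin n) : ∏ a, complexGaussianPDF r (y t a) =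
      ENNReal.ofReal (∏ a, ((Real.pi * r)⁻¹ * Real.exp (-‖y t a‖ ^ 2 / r))) :=
    (ENNReal.ofReal_prod_of_nonneg fun a _ => by positivity).symm
  simp_rw [blockPDF, h]
  rw [← ENNReal.ofReal_prod_of_nonneg fun t _ => by positivity]
  congr 1
  simp_rw [Finset.prod_mul_distrib, ← Real.exp_sum]
  simp [energy, Finset.sum_div, neg_div, Finset.sum_neg_distrib, ← pow_mul,
    mul_comm n m]

lemma measurable_blockPDF : Measurable (blockPDF r : (Fin n → Fin m → ℂ) → ℝ≥0∞) := by
  have := measurable_complexGaussianPDF r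
  unfold blockPDF
  fun_prop

lemma blockPDF_ne_top (y : Fin n → Fin m → ℂ) : blockPDF r y ≠ ∞ := by
  simp [blockPDF_eq]

lemma lintegral_blockPDF (hr : r ≠ 0) :
    ∫⁻ y : Fin n → Fin m → ℂ, blockPDF r y = 1 := by
  have h : ∫⁻ y : Fin m → ℂ, ∏ a, complexGaussianPDF r (y a) = 1 := by
    rw [volume_pi, lintegral_fin_prod_eq_prod fun _ => measurable_complexGaussianPDF r]
    simp [lintegral_complexGaussianPDF hr]
  unfold blockPDF
  rw [volume_pi, lintegral_fin_prod_eq_prod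
    (f := fun (_ : Fin n) (y : Fin m → ℂ) => ∏ a, complexGaussianPDF r (y a))]
  · simp [h]
  · have := measurable_complexGaussianPDF r
    fun_prop

lemma pi_pi_stdComplexGaussian :
    (Measure.pi fun _ : Fin n => Measure.pi fun _ : Fin m => stdComplexGaussian) =
      volume.withDensity (blockPDF 1) := by
  simp_rw [stdComplexGaussian_eq_withDensity]
  rw [pi_withDensity_fin (fun _ => measurable_complexGaussianPDF 1)
    (fun _ _ => ENNReal.ofReal_ne_top), pi_withDensity_fin]
  · rfl
  · have := measurable_complexGaussianPDF 1
    fun_prop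
  · exact fun _ _ => ENNReal.prod_ne_top fun _ _ => ENNReal.ofReal_ne_top

variable {K : ℕ} {M : Fin K → ℕ}

lemma noiseLaw_eq_withDensity :
    noiseLaw M n = volume.withDensity (fun z => ∏ i, blockPDF 1 (z i)) := by
  unfold noiseLaw
  simp_rw [pi_pi_stdComplexGaussian]
  rw [pi_withDensity_fin (fun _ => measurable_blockPDF) (fun _ _ => blockPDF_ne_top _)]
  rfl

instance : IsProbabilityMeasure stdComplexGaussian :=
  Measure.isProbabilityMeasure_map Complex.measurableEquivRealProd.symm.measurable.aemeasurable

instance : IsProbabilityMeasure (noiseLaw M n) := by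
  unfold noiseLaw
  infer_instance

end MIMOIC

end
-- Averages over messages and the general converse bound.
/-- If `g` does not depend on the `i`-th coordinate, then its sums over the fibres of that
coordinate agree. -/
theorem card_smul_sum_fiber_eq_sum {ι : Type*} [Fintype ι] [DecidableEq ι] {V : ι → Type*}
    [∀ i, Fintype (V i)] [∀ i, DecidableEq (V i)] {A : Type*} [AddCommMonoid A] (i : ι)
    (g : (∀ j, V j) → A) (hg : ∀ w v, g (Function.update w i v) = g w) (v : V i) :
    Fintype.card (V i) • ∑ w with w i = v, g w = ∑ w, g w := by
  rw [← Finset.sum_fiberwise (s := Finset.univ) (g := fun w : ∀ j, V j => w i),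
    ← Finset.card_univ, ← Finset.sum_const]
  refine Finset.sum_congr rfl fun v' _ => ?_
  refine Finset.sum_bij' (fun w _ => Function.update w i v') (fun w _ => Function.update w i v)
    ?_ ?_ ?_ ?_ ?_
  · simp
  · simp
  · rintro w hw
    obtain rfl : w i = v := by simpa using hw
    simp
  · rintro w hw
    obtain rfl : w i = v' := by simpa using hw
    simp
  · intro w _
    exact (hg w v').symm

/-- All fibres of a coordinate have the same size. Cross-multiplying the cardinalities avoids
division in `A`. -/
theorem card_smul_sum_comp_eval {ι : Type*} [Fintype ι] [DecidableEq ι] {V : ι → Type*}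
    [∀ i, Fintype (V i)] [∀ i, DecidableEq (V i)] {A : Type*} [AddCommMonoid A] (i : ι)
    (f : V i → A) :
    Fintype.card (V i) • ∑ w : ∀ j, V j, f (w i) = Fintype.card (∀ j, V j) • ∑ v, f v := by
  rw [← Finset.sum_fiberwise (s := Finset.univ) (g := fun w : ∀ j, V j => w i), Finset.smul_sum,
    Finset.smul_sum]
  refine Finset.sum_congr rfl fun v _ => ?_
  have h := card_smul_sum_fiber_eq_sum i (fun _ : ∀ j, V j => (1 : ℕ)) (fun _ _ => rfl) v
  simp only [Finset.sum_const, smul_eq_mul, mul_one, Finset.card_univ] at h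
  rw [Finset.sum_congr rfl fun w hw => by rw [(Finset.mem_filter.1 hw).2], Finset.sum_const,
    ← mul_smul, h]

namespace MeasureTheory

/-- **Verdú–Han type converse.** Among `W` equally likely parameters `w`, the decoder `dec` looks
at `sig (proj w) + int w + z`, where `z` has density `φ`. If the mixture of the densities of
`int w + z` over a fibre of `proj` is `κ • F`, then it is unlikely that the decoder is correct
while `F` is small in comparison with an integrable function `u` of the output. -/
theorem sum_withDensity_correct_le {W V E : Type*} [Fintype W] [Fintype V] [DecidableEq V]
    [MeasurableSpace V] [MeasurableSingletonClass V] [AddCommGroup E] [MeasurableSpace E]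
    [MeasurableAdd E] [MeasurableSub E] (μ : Measure E) [μ.IsAddLeftInvariant]
    (proj : W → V) (sig : V → E) (int : W → E)
    {φ F u : E → ℝ≥0∞} {dec : E → V} (hφ : Measurable φ) (hF : Measurable F) (hu : Measurable u)
    (hdec : Measurable dec) (c κ : ℝ≥0∞)
    (hmix : ∀ v s, ∑ w with proj w = v, φ (s - int w) = κ * F s) :
    ∑ w, μ.withDensity φ {z | dec (sig (proj w) + (int w + z)) = proj w ∧
        F (int w + z) ≤ c * u (sig (proj w) + (int w + z))} ≤ κ * (c * ∫⁻ y, u y ∂μ) := by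
  classical
  set T : V → Set E := fun v => {s | dec (sig v + s) = v ∧ F s ≤ c * u (sig v + s)} with hT
  have hTm (v : V) : MeasurableSet (T v) :=
    ((hdec.comp (measurable_const_add _)) (measurableSet_singleton v)).inter
      (measurableSet_le hF ((hu.comp (measurable_const_add _)).const_mul c))
  have h1 (w : W) : μ.withDensity φ {z | dec (sig (proj w) + (int w + z)) = proj w ∧
        F (int w + z) ≤ c * u (sig (proj w) + (int w + z))} =
      ∫⁻ s, (T (proj w)).indicator (fun s => φ (s - int w)) s ∂μ := by
    have hset : {z | dec (sig (proj w) + (int w + z)) = proj w ∧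
        F (int w + z) ≤ c * u (sig (proj w) + (int w + z))} =
        (fun z => int w + z) ⁻¹' T (proj w) := rfl
    have hm := measurable_const_add (int w) (hTm (proj w))
    -- Substitute `s = int w + z`: the event becomes `T (proj w)`, which depends on `w` only through
    -- `proj w`.
    rw [hset, withDensity_apply _ hm, ← lintegral_indicator hm,
      ← lintegral_add_left_eq_self ((T (proj w)).indicator fun s => φ (s - int w)) (int w)]
    refine lintegral_congr fun z => ?_
    simp [Set.indicator]
  -- The densities over a fibre add up to `κ * F`, which is at most `κ * (c * u)` on `T v`; correct
  -- decoding puts the output in `dec ⁻¹' {v}`. These regions partition the space, so summing over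
  -- `v` costs only one integral of `u`.
  have h2 (v : V) : ∑ w with proj w = v,
      ∫⁻ s, (T (proj w)).indicator (fun s => φ (s - int w)) s ∂μ ≤
      ∫⁻ y, (dec ⁻¹' {v}).indicator (fun y => κ * (c * u y)) y ∂μ := by
    rw [Finset.sum_congr rfl fun w hw => by rw [(Finset.mem_filter.1 hw).2],
      ← lintegral_finsetSum (f := fun w => (T v).indicator fun s => φ (s - int w)) _ fun w _ =>
        (hφ.comp (measurable_id.sub_const (int w))).indicator (hTm v),
      ← lintegral_add_left_eq_self ((dec ⁻¹' {v}).indicator fun y => κ * (c * u y)) (sig v)]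
    refine lintegral_mono fun s => ?_
    by_cases hs : s ∈ T v
    · have hs' : sig v + s ∈ dec ⁻¹' {v} := hs.1
      simp only [Set.indicator_of_mem hs, Set.indicator_of_mem hs', hmix]
      gcongr
      exact hs.2
    · simp [Set.indicator_of_notMem hs]
  calc _ = ∑ v, ∑ w with proj w = v,
        ∫⁻ s, (T (proj w)).indicator (fun s => φ (s - int w)) s ∂μ := by
        rw [Finset.sum_fiberwise]
        exact Finset.sum_congr rfl fun w _ => h1 w
    _ ≤ ∑ v, ∫⁻ y, (dec ⁻¹' {v}).indicator (fun y => κ * (c * u y)) y ∂μ :=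
        Finset.sum_le_sum fun v _ => h2 v
    _ = ∫⁻ y, κ * (c * u y) ∂μ := by
        rw [← lintegral_finsetSum _ fun v _ =>
          ((hu.const_mul c).const_mul κ).indicator (hdec (measurableSet_singleton v))]
        refine lintegral_congr fun y => ?_
        simp [Set.indicator_apply]
    _ = κ * (c * ∫⁻ y, u y ∂μ) := by
        rw [lintegral_const_mul _ (hu.const_mul c), lintegral_const_mul _ hu]

end MeasureTheory

/-! ### The noiseless channel and energy estimates. -/

noncomputable section

namespace MIMOIC

variable {K : ℕ} {M : Fin K → ℕ} {n : ℕ}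

/-- The noiseless channel: from the blocks sent to the blocks received. -/
def mix (H : ChannelGains M) (x : ∀ i : Fin K, Fin n → Fin (M i) → ℂ) :
    ∀ i : Fin K, Fin n → Fin (M i) → ℂ :=
  fun i t => ∑ k, Matrix.of (H i k) *ᵥ x k t

/-- The channel from which the direct links are removed. -/
def cross (H : ChannelGains M) : ChannelGains M :=
  fun i k a b => if i = k then 0 else H i k a b

/-- The energy of a block at all users. -/
def totalEnergy (z : ∀ i : Fin K, Fin n → Fin (M i) → ℂ) : ℝ := ∑ i, energy (z i)

/-- The sum of the squares of all channel gains. -/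
def gainEnergy (H : ChannelGains M) : ℝ := ∑ i, ∑ a, ∑ k, ∑ b, ‖H i k a b‖ ^ 2

lemma totalEnergy_nonneg (z : ∀ i : Fin K, Fin n → Fin (M i) → ℂ) : 0 ≤ totalEnergy z :=
  Finset.sum_nonneg fun _ _ => energy_nonneg _

lemma gainEnergy_nonneg (H : ChannelGains M) : 0 ≤ gainEnergy H := by
  unfold gainEnergy; positivity

lemma mix_apply (H : ChannelGains M) (x : ∀ i : Fin K, Fin n → Fin (M i) → ℂ) (i t a) :
    mix H x i t a = ∑ k, ∑ b, H i k a b * x k t b := by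
  simp [mix, Finset.sum_apply, Matrix.mulVec, dotProduct]

lemma mix_add (H : ChannelGains M) (x y : ∀ i : Fin K, Fin n → Fin (M i) → ℂ) :
    mix H (x + y) = mix H x + mix H y := by
  ext i t a
  simp [mix_apply, mul_add, Finset.sum_add_distrib]

lemma mix_eq_direct_add_cross (H : ChannelGains M) (x : ∀ i : Fin K, Fin n → Fin (M i) → ℂ) (i) :
    mix H x i = (fun t => Matrix.of (H i i) *ᵥ x i t) + mix (cross H) x i := by
  ext t a
  rw [Pi.add_apply, Pi.add_apply, mix_apply, mix_apply,
    ← Finset.add_sum_erase _ _ (Finset.mem_univ i),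
    ← Finset.add_sum_erase _ (fun k => ∑ b, cross H i k a b * x k t b) (Finset.mem_univ i)]
  simp only [cross, if_true, zero_mul, Finset.sum_const_zero, zero_add]
  congr 1
  refine Finset.sum_congr rfl fun k hk => ?_
  simp [(Finset.ne_of_mem_erase hk).symm]

lemma mix_cross_update (H : ChannelGains M) (x y : ∀ i : Fin K, Fin n → Fin (M i) → ℂ) (i)
    (h : ∀ k, k ≠ i → x k = y k) : mix (cross H) x i = mix (cross H) y i := by
  ext t a
  rw [mix_apply, mix_apply]
  refine Finset.sum_congr rfl fun k _ => ?_
  by_cases hk : i = k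
  · simp [cross, hk]
  · rw [h k (Ne.symm hk)]

lemma measurable_mix (H : ChannelGains M) :
    Measurable (mix H : (∀ i : Fin K, Fin n → Fin (M i) → ℂ) → _) := by
  refine measurable_pi_lambda _ fun i => measurable_pi_lambda _ fun t =>
    measurable_pi_lambda _ fun a => ?_
  simp_rw [mix_apply]
  fun_prop

lemma totalEnergy_eq_sum (z : ∀ i : Fin K, Fin n → Fin (M i) → ℂ) :
    totalEnergy z = ∑ t, ∑ p : Σ i, Fin (M i), ‖z p.1 t p.2‖ ^ 2 := by
  simp_rw [totalEnergy, energy, Fintype.sum_sigma]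
  rw [Finset.sum_comm]

/-- Cauchy–Schwarz on each row of the gain matrix; `gainEnergy` is its squared Frobenius norm. -/
lemma totalEnergy_mix_le (H : ChannelGains M) (x : ∀ i : Fin K, Fin n → Fin (M i) → ℂ) :
    totalEnergy (mix H x) ≤ gainEnergy H * totalEnergy x := by
  rw [totalEnergy_eq_sum, totalEnergy_eq_sum, Finset.mul_sum]
  refine Finset.sum_le_sum fun t _ => ?_
  have hg : gainEnergy H = ∑ p : Σ i, Fin (M i), ∑ q : Σ i, Fin (M i),
      ‖H p.1 q.1 p.2 q.2‖ ^ 2 := by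
    simp_rw [gainEnergy, Fintype.sum_sigma]
  rw [hg, Finset.sum_mul]
  refine Finset.sum_le_sum fun p _ => ?_
  have h1 : mix H x p.1 t p.2 = ∑ q : Σ i, Fin (M i), H p.1 q.1 p.2 q.2 * x q.1 t q.2 := by
    rw [mix_apply, Fintype.sum_sigma]
  rw [h1]
  refine le_trans ?_ (Finset.sum_mul_sq_le_sq_mul_sq _ _ _)
  gcongr
  exact (norm_sum_le _ _).trans_eq (by simp_rw [norm_mul])

lemma totalEnergy_add_le (x y : ∀ i : Fin K, Fin n → Fin (M i) → ℂ) :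
    totalEnergy (x + y) ≤ 2 * totalEnergy x + 2 * totalEnergy y := by
  simp_rw [totalEnergy_eq_sum, Finset.mul_sum, ← Finset.sum_add_distrib]
  refine Finset.sum_le_sum fun t _ => Finset.sum_le_sum fun p _ => ?_
  have h := norm_add_le (x p.1 t p.2) (y p.1 t p.2)
  simp only [Pi.add_apply]
  nlinarith [sq_nonneg (‖x p.1 t p.2‖ - ‖y p.1 t p.2‖),
    norm_nonneg (x p.1 t p.2 + y p.1 t p.2)]

lemma totalEnergy_neg (x : ∀ i : Fin K, Fin n → Fin (M i) → ℂ) :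
    totalEnergy (-x) = totalEnergy x := by
  simp [totalEnergy_eq_sum]

lemma prod_blockPDF_eq (r : ℝ≥0) (z : ∀ i : Fin K, Fin n → Fin (M i) → ℂ) :
    ∏ i, blockPDF r (z i) =
      ENNReal.ofReal ((Real.pi * r)⁻¹ ^ (n * ∑ i, M i) * Real.exp (-totalEnergy z / r)) := by
  simp_rw [blockPDF_eq]
  rw [← ENNReal.ofReal_prod_of_nonneg fun i _ => by positivity, Finset.prod_mul_distrib,
    ← Real.exp_sum, Finset.prod_pow_eq_pow_sum, ← Finset.mul_sum, ← Finset.sum_div,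
    Finset.sum_neg_distrib]
  rfl

lemma lintegral_prod_blockPDF {r : ℝ≥0} (hr : r ≠ 0) :
    ∫⁻ z : ∀ i : Fin K, Fin n → Fin (M i) → ℂ, ∏ i, blockPDF r (z i) = 1 := by
  rw [volume_pi, lintegral_fin_prod_eq_prod fun _ => measurable_blockPDF]
  simp [lintegral_blockPDF hr]

lemma measurable_prod_blockPDF {r : ℝ≥0} : Measurable
    fun z : ∀ i : Fin K, Fin n → Fin (M i) → ℂ => ∏ i, blockPDF r (z i) :=
  Finset.measurable_prod _ fun i _ => measurable_blockPDF.comp (measurable_pi_apply i)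

end MIMOIC

end
-- Density comparisons for interference and for the joint output.
noncomputable section

namespace MIMOIC

variable {K : ℕ} {M : Fin K → ℕ} {n : ℕ} {V : Fin K → Type} [∀ i, Fintype (V i)]

instance : (volume : Measure (∀ i : Fin K, Fin n → Fin (M i) → ℂ)).IsAddLeftInvariant := by
  rw [volume_pi]
  exact Measure.pi.isAddLeftInvariant _

/-- The general converse is also applied on the space of pairs of blocks, which needs measurable
translations and an invariant measure there. -/
instance : MeasurableAdd
    ((∀ i : Fin K, Fin n → Fin (M i) → ℂ) × (∀ i : Fin K, Fin n → Fin (M i) → ℂ)) :=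
  ⟨fun c => ((measurable_const_add c.1).comp measurable_fst).prodMk
    ((measurable_const_add c.2).comp measurable_snd),
   fun c => ((measurable_add_const c.1).comp measurable_fst).prodMk
    ((measurable_add_const c.2).comp measurable_snd)⟩

instance : MeasurableSub
    ((∀ i : Fin K, Fin n → Fin (M i) → ℂ) × (∀ i : Fin K, Fin n → Fin (M i) → ℂ)) :=
  ⟨fun c => ((measurable_const_sub c.1).comp measurable_fst).prodMk
    ((measurable_const_sub c.2).comp measurable_snd),
   fun c => ((measurable_sub_const c.1).comp measurable_fst).prodMk
    ((measurable_sub_const c.2).comp measurable_snd)⟩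

instance : ((volume : Measure (∀ i : Fin K, Fin n → Fin (M i) → ℂ)).prod
    (volume : Measure (∀ i : Fin K, Fin n → Fin (M i) → ℂ))).IsAddLeftInvariant :=
  Measure.prod.instIsAddLeftInvariant

/-- The blocks sent when the messages are `w`. -/
def sent (enc : ∀ i, V i → Fin n → Fin (M i) → ℂ) (w : ∀ i, V i) :
    ∀ i : Fin K, Fin n → Fin (M i) → ℂ := fun i => enc i (w i)

/-- The density of interference plus noise at receiver `i`, for uniform messages. -/
def interferencePDF (H : ChannelGains M) (enc : ∀ i, V i → Fin n → Fin (M i) → ℂ) (i : Fin K)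
    (s : Fin n → Fin (M i) → ℂ) : ℝ≥0∞ :=
  (∑ w : ∀ i, V i, blockPDF 1 (s - mix (cross H) (sent enc w) i)) / Fintype.card (∀ i, V i)

lemma measurable_interferencePDF (H : ChannelGains M)
    (enc : ∀ i, V i → Fin n → Fin (M i) → ℂ) (i : Fin K) :
    Measurable (interferencePDF H enc i) := by
  unfold interferencePDF
  simp_rw [div_eq_mul_inv]
  exact (Finset.measurable_sum _ fun w _ =>
    measurable_blockPDF.comp (measurable_id.sub_const _)).mul_const _

lemma lintegral_interferencePDF [∀ i, Nonempty (V i)] (H : ChannelGains M)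
    (enc : ∀ i, V i → Fin n → Fin (M i) → ℂ) (i : Fin K) :
    ∫⁻ s, interferencePDF H enc i s = 1 := by
  unfold interferencePDF
  simp_rw [div_eq_mul_inv]
  have hm (c : Fin n → Fin (M i) → ℂ) : Measurable fun s => blockPDF 1 (s - c) :=
    measurable_blockPDF.comp (measurable_id.sub_const _)
  rw [lintegral_mul_const _ (Finset.measurable_sum _ fun w _ => hm _),
    lintegral_finsetSum _ fun w _ => hm _]
  simp_rw [lintegral_sub_right_eq_self (blockPDF 1), lintegral_blockPDF one_ne_zero]
  rw [Finset.sum_const, Finset.card_univ, nsmul_eq_mul, mul_one,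
    ENNReal.mul_inv_cancel (Nat.cast_ne_zero.2 Fintype.card_ne_zero)
      (ENNReal.natCast_ne_top _)]

/-- Interference at receiver `i` does not involve message `i`, so conditioning on that message
leaves its law unchanged. -/
lemma sum_fiber_blockPDF [∀ i, DecidableEq (V i)] [∀ i, Nonempty (V i)] (H : ChannelGains M)
    (enc : ∀ i, V i → Fin n → Fin (M i) → ℂ) (i : Fin K) (v : V i)
    (s : Fin n → Fin (M i) → ℂ) :
    ∑ w with w i = v, blockPDF 1 (s - mix (cross H) (sent enc w) i) =
      (Fintype.card (∀ i, V i) : ℝ≥0∞) / Fintype.card (V i) * interferencePDF H enc i s := by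
  have h := card_smul_sum_fiber_eq_sum i
    (fun w => blockPDF 1 (s - mix (cross H) (sent enc w) i)) (fun w v => by
      rw [mix_cross_update H _ (sent enc w) i]
      intro k hk
      simp [sent, Function.update_of_ne hk]) v
  have h0 : (Fintype.card (V i) : ℝ≥0∞) ≠ 0 := Nat.cast_ne_zero.2 Fintype.card_ne_zero
  have h0' : (Fintype.card (∀ i, V i) : ℝ≥0∞) ≠ 0 :=
    Nat.cast_ne_zero.2 Fintype.card_ne_zero
  rw [interferencePDF, ← h, nsmul_eq_mul, ← mul_div_assoc, ← mul_assoc,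
    ENNReal.div_mul_cancel h0 (by simp), mul_comm, mul_div_assoc,
    ENNReal.div_self h0' (ENNReal.natCast_ne_top _), mul_one]

/-- One-shot form of `n R_i ≲ h(Y_i) - h(S_i)`, with a Gaussian of power `ρ` as test density for the
output. -/
lemma sum_noiseLaw_interference_le [∀ i, DecidableEq (V i)] [∀ i, MeasurableSpace (V i)]
    [∀ i, MeasurableSingletonClass (V i)] [∀ i, Nonempty (V i)] (H : ChannelGains M)
    (enc : ∀ i, V i → Fin n → Fin (M i) → ℂ) (dec : ∀ i, (Fin n → Fin (M i) → ℂ) → V i)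
    (hdec : ∀ i, Measurable (dec i)) (i : Fin K) (γ : ℝ≥0∞) {ρ : ℝ≥0} (hρ : ρ ≠ 0) :
    ∑ w : ∀ i, V i, noiseLaw M n {z | dec i ((mix H (sent enc w) + z) i) = w i ∧
      interferencePDF H enc i ((mix (cross H) (sent enc w) + z) i) ≤
        γ * Fintype.card (V i) * blockPDF ρ ((mix H (sent enc w) + z) i)} ≤
      γ * Fintype.card (∀ i, V i) := by
  have key := sum_withDensity_correct_le volume (fun w : ∀ i, V i => w i)
    (fun v t => Matrix.of (H i i) *ᵥ enc i v t) (fun w => mix (cross H) (sent enc w) i)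
    (measurable_blockPDF (r := 1)) (measurable_interferencePDF H enc i)
    (measurable_blockPDF (r := ρ)) (hdec i) (γ * Fintype.card (V i))
    ((Fintype.card (∀ i, V i) : ℝ≥0∞) / Fintype.card (V i))
    (fun v s => sum_fiber_blockPDF H enc i v s)
  refine (Finset.sum_le_sum fun w _ => ?_).trans (key.trans_eq ?_)
  · have hle := Measure.le_map_apply (μ := noiseLaw M n) (f := fun z => z i)
      (measurable_pi_apply i).aemeasurable
      {z | dec i (mix H (sent enc w) i + z) = w i ∧
        interferencePDF H enc i (mix (cross H) (sent enc w) i + z) ≤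
        γ * Fintype.card (V i) * blockPDF ρ (mix H (sent enc w) i + z)}
    have hmap : (noiseLaw M n).map (fun z => z i) = volume.withDensity (blockPDF 1) := by
      rw [← pi_pi_stdComplexGaussian]
      exact (measurePreserving_eval (fun i => Measure.pi fun _ : Fin n =>
        Measure.pi fun _ : Fin (M i) => stdComplexGaussian) i).map_eq
    rw [hmap] at hle
    refine hle.trans (measure_mono fun z hz => ?_)
    rw [Set.mem_ofPred_eq] at hz ⊢
    rw [mix_eq_direct_add_cross, add_assoc] at hz
    exact hz
  · rw [lintegral_blockPDF hρ, mul_one, mul_comm γ, ← mul_assoc,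
      ENNReal.div_mul_cancel (by simp) (by simp), mul_comm]

/-- A test density on pairs of output and interference blocks. -/
def jointTestPDF (H A : ChannelGains M) (enc : ∀ i, V i → Fin n → Fin (M i) → ℂ) (r : ℝ≥0)
    (p : (∀ i : Fin K, Fin n → Fin (M i) → ℂ) × (∀ i : Fin K, Fin n → Fin (M i) → ℂ)) : ℝ≥0∞ :=
  (∏ i, interferencePDF H enc i (p.2 i)) * ∏ i, blockPDF r ((p.1 - mix A p.2) i)

lemma measurable_jointTestPDF (H A : ChannelGains M)
    (enc : ∀ i, V i → Fin n → Fin (M i) → ℂ) (r : ℝ≥0) :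
    Measurable (jointTestPDF H A enc r) := by
  refine Measurable.mul ?_ ?_
  · exact Finset.measurable_prod _ fun i _ => (measurable_interferencePDF H enc i).comp
      ((measurable_pi_apply i).comp measurable_snd)
  · exact measurable_prod_blockPDF.comp
      (measurable_fst.sub ((measurable_mix A).comp measurable_snd))

/-- For fixed interference the output factor is a translated Gaussian, so integrating over outputs
first leaves a product of probability densities. -/
lemma lintegral_jointTestPDF [∀ i, Nonempty (V i)] (H A : ChannelGains M)
    (enc : ∀ i, V i → Fin n → Fin (M i) → ℂ) {r : ℝ≥0} (hr : r ≠ 0) :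
    ∫⁻ p, jointTestPDF H A enc r p ∂(volume.prod volume) = 1 := by
  rw [lintegral_prod_symm _ (measurable_jointTestPDF H A enc r).aemeasurable]
  unfold jointTestPDF
  have h (s : ∀ i : Fin K, Fin n → Fin (M i) → ℂ) :
      ∫⁻ y : ∀ i : Fin K, Fin n → Fin (M i) → ℂ, (∏ i, interferencePDF H enc i (s i)) *
        ∏ i, blockPDF r ((y - mix A s) i) = ∏ i, interferencePDF H enc i (s i) := by
    have hm : Measurable fun y : ∀ i : Fin K, Fin n → Fin (M i) → ℂ =>
        ∏ i, blockPDF r ((y - mix A s) i) :=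
      measurable_prod_blockPDF.comp (measurable_id.sub_const _)
    rw [lintegral_const_mul _ hm,
      lintegral_sub_right_eq_self
        (fun y : ∀ i : Fin K, Fin n → Fin (M i) → ℂ => ∏ i, blockPDF r (y i)),
      lintegral_prod_blockPDF hr, mul_one]
  simp_rw [h]
  rw [volume_pi, lintegral_fin_prod_eq_prod fun i => measurable_interferencePDF H enc i]
  simp [lintegral_interferencePDF]

/-- One-shot form of the bound from decoding all messages given `(Y, S)`: the whole message tuple is
the signal, and the two independent noises form the density. -/
lemma sum_noiseLaw_prod_joint_le [∀ i, DecidableEq (V i)] [∀ i, MeasurableSpace (V i)]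
    [∀ i, MeasurableSingletonClass (V i)] [∀ i, Nonempty (V i)] (H A : ChannelGains M)
    (enc : ∀ i, V i → Fin n → Fin (M i) → ℂ) (dec : ∀ i, (Fin n → Fin (M i) → ℂ) → V i)
    (hdec : ∀ i, Measurable (dec i)) (γ : ℝ≥0∞) {r : ℝ≥0} (hr : r ≠ 0) :
    ∑ w : ∀ i, V i, ((noiseLaw M n).prod (noiseLaw M n))
      {p | (∀ i, dec i ((mix H (sent enc w) + p.1) i) = w i) ∧
        (∏ i, blockPDF 1 (p.1 i)) * (∏ i, blockPDF 1 (p.2 i)) ≤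
          γ * Fintype.card (∀ i, V i) * jointTestPDF H A enc r
            (mix H (sent enc w) + p.1, mix (cross H) (sent enc w) + p.2)} ≤
      γ * Fintype.card (∀ i, V i) := by
  have hφ : Measurable fun p : (∀ i : Fin K, Fin n → Fin (M i) → ℂ) ×
      (∀ i : Fin K, Fin n → Fin (M i) → ℂ) =>
      (∏ i, blockPDF 1 (p.1 i)) * (∏ i, blockPDF 1 (p.2 i)) :=
    (measurable_prod_blockPDF.comp measurable_fst).mul
      (measurable_prod_blockPDF.comp measurable_snd)
  have key := sum_withDensity_correct_le (volume.prod volume) (id : (∀ i, V i) → _)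
    (fun w => (mix H (sent enc w), mix (cross H) (sent enc w))) (fun _ => 0) hφ hφ
    (measurable_jointTestPDF H A enc r)
    (dec := fun p i => dec i (p.1 i))
    (measurable_pi_lambda _ fun i => (hdec i).comp
      ((measurable_pi_apply i).comp measurable_fst)) (γ * Fintype.card (∀ i, V i)) 1
    (fun v s => by simp [Finset.filter_eq'])
  rw [lintegral_jointTestPDF H A enc hr, mul_one, one_mul] at key
  rw [noiseLaw_eq_withDensity, prod_withDensity measurable_prod_blockPDF measurable_prod_blockPDF]
  refine (Finset.sum_le_sum fun w _ => measure_mono fun p hp => ?_).trans key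
  refine ⟨?_, ?_⟩
  · ext i
    simpa using hp.1 i
  · rw [zero_add]
    exact hp.2

end MIMOIC

end
-- The one-shot converse.
noncomputable section

namespace MIMOIC

variable {K : ℕ} {M : Fin K → ℕ} {n : ℕ} {V : Fin K → Type} [∀ i, Fintype (V i)]

lemma sum_totalEnergy_sent_le [∀ i, Nonempty (V i)]
    (enc : ∀ i, V i → Fin n → Fin (M i) → ℂ) {E : ℝ}
    (henc : ∀ i, ∑ v, energy (enc i v) ≤ Fintype.card (V i) * E) :
    ∑ w, totalEnergy (sent enc w) ≤ Fintype.card (∀ i, V i) * (K * E) := by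
  classical
  have h (i : Fin K) : ∑ w : ∀ i, V i, energy (enc i (w i)) ≤ Fintype.card (∀ i, V i) * E := by
    have h1 := card_smul_sum_comp_eval i (fun v => energy (enc i v))
    rw [nsmul_eq_mul, nsmul_eq_mul] at h1
    have h0 : (0 : ℝ) < Fintype.card (V i) := Nat.cast_pos.2 Fintype.card_pos
    refine le_of_mul_le_mul_left ?_ h0
    rw [h1]
    calc _ ≤ (Fintype.card (∀ i, V i) : ℝ) * (Fintype.card (V i) * E) := by gcongr; exact henc i
      _ = _ := by ring
  simp_rw [totalEnergy, sent]
  rw [Finset.sum_comm]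
  refine (Finset.sum_le_sum fun i _ => h i).trans_eq ?_
  simp
  ring

/-- Markov's inequality, the mean being at most `K * E`. The factor `K + 1` keeps the threshold
positive for `K = 0`. -/
lemma card_filter_totalEnergy_le [∀ i, Nonempty (V i)]
    (enc : ∀ i, V i → Fin n → Fin (M i) → ℂ) {E : ℝ} (hE : 0 < E)
    (henc : ∀ i, ∑ v, energy (enc i v) ≤ Fintype.card (V i) * E) :
    (Finset.card {w : ∀ i, V i | 4 * (K + 1) * E < totalEnergy (sent enc w)} : ℝ) ≤
      Fintype.card (∀ i, V i) / 4 := by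
  have h1 := sum_totalEnergy_sent_le enc henc
  have h2 : (Finset.card {w : ∀ i, V i | 4 * (K + 1) * E < totalEnergy (sent enc w)} : ℝ) *
      (4 * (K + 1) * E) ≤ ∑ w, totalEnergy (sent enc w) := by
    rw [← nsmul_eq_mul, ← Finset.sum_const]
    refine (Finset.sum_le_sum fun w hw => (Finset.mem_filter.1 hw).2.le).trans ?_
    exact Finset.sum_le_sum_of_subset_of_nonneg (Finset.filter_subset _ _)
      fun w _ _ => totalEnergy_nonneg _
  have h3 : (0 : ℝ) < (K + 1) * E := by positivity
  refine le_of_mul_le_mul_right ?_ h3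
  have h4 : (Fintype.card (∀ i, V i) : ℝ) * (K * E) ≤ Fintype.card (∀ i, V i) * ((K + 1) * E) := by
    gcongr
    linarith
  linarith

variable [∀ i, DecidableEq (V i)] [∀ i, MeasurableSpace (V i)]
  [∀ i, MeasurableSingletonClass (V i)] [∀ i, Nonempty (V i)]

/-- For a good code there are messages and noise blocks for which the densities are related as
they typically are. -/
lemma exists_typical (H A : ChannelGains M)
    (enc : ∀ i, V i → Fin n → Fin (M i) → ℂ) (dec : ∀ i, (Fin n → Fin (M i) → ℂ) → V i)
    (hdec : ∀ i, Measurable (dec i)) {E : ℝ} (hE : 0 < E)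
    (henc : ∀ i, ∑ v, energy (enc i v) ≤ Fintype.card (V i) * E)
    (herr : ∑ w : ∀ i, V i, noiseLaw M n {z | ∃ i, dec i ((mix H (sent enc w) + z) i) ≠ w i} ≤
      ENNReal.ofReal (Fintype.card (∀ i, V i) / 8))
    {γ : ℝ} (hγ0 : 0 ≤ γ) (hγ : (K + 1) * γ ≤ 1 / 4) {ρ r : ℝ≥0} (hρ : ρ ≠ 0) (hr : r ≠ 0) :
    ∃ (w : ∀ i, V i) (z z' : ∀ i : Fin K, Fin n → Fin (M i) → ℂ),
      totalEnergy (sent enc w) ≤ 4 * (K + 1) * E ∧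
      (∀ i, ENNReal.ofReal γ * Fintype.card (V i) * blockPDF ρ ((mix H (sent enc w) + z') i) ≤
        interferencePDF H enc i ((mix (cross H) (sent enc w) + z') i)) ∧
      ENNReal.ofReal γ * Fintype.card (∀ i, V i) * jointTestPDF H A enc r
            (mix H (sent enc w) + z, mix (cross H) (sent enc w) + z') ≤
        (∏ i, blockPDF 1 (z i)) * (∏ i, blockPDF 1 (z' i)) := by
  -- Union bound: decoding errors under `z` and `z'` cost `1/8` each, the density comparisons `(K +
  -- 1) γ ≤ 1/4`, and excess power `1/4`, in total at most `3/4 < 1`.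
  by_contra! hcon
  set N : ℝ := ((Fintype.card (∀ i, V i) : ℕ) : ℝ) with hN
  have hN0 : 0 < N := Nat.cast_pos.2 Fintype.card_pos
  have hNE : (Fintype.card (∀ i, V i) : ℝ≥0∞) = ENNReal.ofReal N :=
    (ENNReal.ofReal_natCast _).symm
  set ν := (noiseLaw M n).prod (noiseLaw M n) with hν
  set S : (∀ i, V i) → Set (∀ i : Fin K, Fin n → Fin (M i) → ℂ) :=
    fun w => {z | ∃ i, dec i ((mix H (sent enc w) + z) i) ≠ w i} with hS
  set T : Fin K → (∀ i, V i) → Set (∀ i : Fin K, Fin n → Fin (M i) → ℂ) :=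
    fun i w => {z | dec i ((mix H (sent enc w) + z) i) = w i ∧
      interferencePDF H enc i ((mix (cross H) (sent enc w) + z) i) ≤
        ENNReal.ofReal γ * Fintype.card (V i) * blockPDF ρ ((mix H (sent enc w) + z) i)} with hT
  set U : (∀ i, V i) → Set ((∀ i : Fin K, Fin n → Fin (M i) → ℂ) ×
      (∀ i : Fin K, Fin n → Fin (M i) → ℂ)) := fun w =>
      {p | (∀ i, dec i ((mix H (sent enc w) + p.1) i) = w i) ∧
        (∏ i, blockPDF 1 (p.1 i)) * (∏ i, blockPDF 1 (p.2 i)) ≤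
          ENNReal.ofReal γ * Fintype.card (∀ i, V i) * jointTestPDF H A enc r
            (mix H (sent enc w) + p.1, mix (cross H) (sent enc w) + p.2)} with hU
  have hfst (s : Set (∀ i : Fin K, Fin n → Fin (M i) → ℂ)) :
      ν (Prod.fst ⁻¹' s) ≤ noiseLaw M n s := by
    rw [← Set.prod_univ, hν, Measure.prod_prod]
    simp
  have hsnd (s : Set (∀ i : Fin K, Fin n → Fin (M i) → ℂ)) :
      ν (Prod.snd ⁻¹' s) ≤ noiseLaw M n s := by
    rw [← Set.univ_prod, hν, Measure.prod_prod]
    simp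
  have hcover (w : ∀ i, V i) : (1 : ℝ≥0∞) ≤ noiseLaw M n (S w) + noiseLaw M n (S w) +
      ∑ i, noiseLaw M n (T i w) + ν (U w) +
      (if 4 * (K + 1) * E < totalEnergy (sent enc w) then 1 else 0) := by
    by_cases hw : 4 * (K + 1) * E < totalEnergy (sent enc w)
    · rw [if_pos hw]
      exact le_add_self
    rw [if_neg hw, add_zero]
    have hsub : Set.univ ⊆ Prod.fst ⁻¹' S w ∪ Prod.snd ⁻¹' S w ∪
        (⋃ i, Prod.snd ⁻¹' T i w) ∪ U w := by
      rintro ⟨z, z'⟩ -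
      by_contra hnot
      simp only [Set.mem_union, Set.mem_iUnion, Set.mem_preimage, not_or, not_exists] at hnot
      obtain ⟨⟨⟨h1, h2⟩, h3⟩, h4⟩ := hnot
      have h1' : ∀ i, dec i ((mix H (sent enc w) + z) i) = w i := by
        intro i
        by_contra h
        exact h1 ⟨i, h⟩
      have h2' : ∀ i, dec i ((mix H (sent enc w) + z') i) = w i := by
        intro i
        by_contra h
        exact h2 ⟨i, h⟩
      refine h4 ⟨h1', (hcon w z z' (not_lt.1 hw) fun i => ?_).le⟩
      by_contra h
      exact h3 i ⟨h2' i, (not_le.1 h).le⟩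
    calc (1 : ℝ≥0∞) = ν Set.univ := by simp [hν]
      _ ≤ _ := measure_mono hsub
      _ ≤ ν (Prod.fst ⁻¹' S w) + ν (Prod.snd ⁻¹' S w) + ∑ i, ν (Prod.snd ⁻¹' T i w) + ν (U w) := by
        refine (measure_union_le _ _).trans (add_le_add ?_ le_rfl)
        refine (measure_union_le _ _).trans (add_le_add (measure_union_le _ _) ?_)
        exact (measure_iUnion_le _).trans_eq (tsum_fintype _)
      _ ≤ _ := by
        gcongr
        exacts [hfst _, hsnd _, hsnd _]
  have hsum := Finset.sum_le_sum fun w (_ : w ∈ Finset.univ) => hcover w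
  simp only [Finset.sum_add_distrib] at hsum
  have hcomm : ∑ w, ∑ i, noiseLaw M n (T i w) = ∑ i, ∑ w, noiseLaw M n (T i w) := Finset.sum_comm
  rw [hcomm, Finset.sum_boole] at hsum
  have hTle : ∑ i, ∑ w, noiseLaw M n (T i w) ≤ ENNReal.ofReal (K * (γ * N)) := by
    refine (Finset.sum_le_sum fun i _ =>
      sum_noiseLaw_interference_le H enc dec hdec i (ENNReal.ofReal γ) hρ).trans_eq ?_
    rw [hNE, ← ENNReal.ofReal_mul hγ0, Finset.sum_const, Finset.card_univ, Fintype.card_fin,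
      nsmul_eq_mul, ENNReal.ofReal_mul (by positivity : (0 : ℝ) ≤ K), ENNReal.ofReal_natCast]
  have hUle : ∑ w, ν (U w) ≤ ENNReal.ofReal (γ * N) := by
    refine (sum_noiseLaw_prod_joint_le H A enc dec hdec (ENNReal.ofReal γ) hr).trans_eq ?_
    rw [hNE, ← ENNReal.ofReal_mul hγ0]
  have hcard := card_filter_totalEnergy_le enc hE henc
  have hcard' : (Finset.card {w : ∀ i, V i | 4 * (K + 1) * E < totalEnergy (sent enc w)} : ℝ≥0∞) ≤
      ENNReal.ofReal (N / 4) := by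
    rw [← ENNReal.ofReal_natCast]
    exact ENNReal.ofReal_le_ofReal hcard
  have hfinal := hsum.trans
    (add_le_add (add_le_add (add_le_add (add_le_add herr herr) hTle) hUle) hcard')
  rw [Finset.sum_const, Finset.card_univ, nsmul_eq_mul, mul_one, hNE,
    ← ENNReal.ofReal_add (by positivity) (by positivity),
    ← ENNReal.ofReal_add (by positivity) (by positivity),
    ← ENNReal.ofReal_add (by positivity) (by positivity),
    ← ENNReal.ofReal_add (by positivity) (by positivity),
    ENNReal.ofReal_le_ofReal_iff (by positivity)] at hfinal
  nlinarith

/-- The one-shot converse: if interference alone determines the output (`A` maps the output of the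
cross links to the output of the whole channel), then a good code has few messages. -/
theorem card_sq_le (H A : ChannelGains M)
    (hA : ∀ x : ∀ i : Fin K, Fin n → Fin (M i) → ℂ, mix A (mix (cross H) x) = mix H x)
    (enc : ∀ i, V i → Fin n → Fin (M i) → ℂ) (dec : ∀ i, (Fin n → Fin (M i) → ℂ) → V i)
    (hdec : ∀ i, Measurable (dec i)) {P : ℝ} (hP : 1 ≤ P) (hn : 0 < n)
    (henc : ∀ i, ∑ v, energy (enc i v) ≤ Fintype.card (V i) * (n * P))
    (herr : ∑ w : ∀ i, V i, noiseLaw M n {z | ∃ i, dec i ((mix H (sent enc w) + z) i) ≠ w i} ≤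
      ENNReal.ofReal (Fintype.card (∀ i, V i) / 8)) :
    (1 / (4 * (K + 1)) : ℝ) ^ (K + 1) * (Fintype.card (∀ i, V i) : ℝ) ^ 2 ≤
      (4 * P * (4 * (1 + gainEnergy A))) ^ (n * ∑ i, M i) *
        Real.exp (n * (2 * (K + 1) * gainEnergy H)) := by
  have hn' : (0 : ℝ) < n := Nat.cast_pos.2 hn
  set γ : ℝ := 1 / (4 * (K + 1)) with hγ
  have hγ0 : 0 < γ := by positivity
  have hCA := gainEnergy_nonneg A
  have hCH := gainEnergy_nonneg H
  -- With these powers the test Gaussians cost at most `totalEnergy z' / 2` and `(totalEnergy z +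
  -- totalEnergy z') / 2` in the exponent, up to a term linear in `n`. The true noise exponent
  -- absorbs both, so no concentration of the noise energy is needed.
  set ρ : ℝ := 4 * P with hρ
  set r : ℝ := 4 * (1 + gainEnergy A) with hr
  have hρ0 : 0 < ρ := by positivity
  have hr0 : 0 < r := by positivity
  obtain ⟨w, z, z', hx, hi, hj⟩ := exists_typical H A enc dec hdec (by positivity : 0 < n * P)
    henc herr hγ0.le (by rw [hγ]; field_simp; norm_num)
    (ρ := ρ.toNNReal) (r := r.toNNReal) (by simpa using hρ0) (by simpa using hr0)
  set x := sent enc w with hxdef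
  -- The codewords cancel: given the interference, only noise remains in the output.
  have hdiff : mix H x + z - mix A (mix (cross H) x + z') = z + -mix A z' := by
    rw [mix_add, hA]
    abel
  have hprod : ENNReal.ofReal γ ^ K * Fintype.card (∀ i, V i) *
      ∏ i, blockPDF ρ.toNNReal ((mix H x + z') i) ≤
      ∏ i, interferencePDF H enc i ((mix (cross H) x + z') i) := by
    refine le_trans (le_of_eq ?_) (Finset.prod_le_prod' fun i _ => hi i)
    rw [Finset.prod_mul_distrib, Finset.prod_mul_distrib, Finset.prod_const, Finset.card_univ,
      Fintype.card_fin, Fintype.card_pi, Nat.cast_prod]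
  -- The product of the `interferencePDF` values is a lower bound's target in `hprod` and a factor
  -- of `jointTestPDF`; chaining eliminates it and leaves only Gaussian densities.
  have hle := le_trans (mul_le_mul' le_rfl (mul_le_mul' hprod le_rfl)) hj
  dsimp only at hle
  rw [hdiff] at hle
  simp only [prod_blockPDF_eq] at hle
  rw [← ENNReal.ofReal_natCast, ← ENNReal.ofReal_pow hγ0.le,
    ← ENNReal.ofReal_mul (by positivity), ← ENNReal.ofReal_mul (by positivity),
    ← ENNReal.ofReal_mul (by positivity), ← ENNReal.ofReal_mul (by positivity),
    ← ENNReal.ofReal_mul (by positivity), ← ENNReal.ofReal_mul (by positivity),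
    ENNReal.ofReal_le_ofReal_iff (by positivity), Real.coe_toNNReal _ hρ0.le,
    Real.coe_toNNReal _ hr0.le] at hle
  simp only [NNReal.coe_one, mul_one, div_one] at hle
  set m := n * ∑ i, M i
  set N : ℝ := ((Fintype.card (∀ i, V i) : ℕ) : ℝ)
  set Q1 := totalEnergy (mix H x + z')
  set Q2 := totalEnergy (z + -mix A z')
  have hQ1 : Q1 / ρ ≤ n * (2 * (K + 1) * gainEnergy H) + totalEnergy z' / 2 := by
    have h1 : Q1 ≤ 2 * (gainEnergy H * totalEnergy x) + 2 * totalEnergy z' :=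
      (totalEnergy_add_le _ _).trans (by gcongr; exact totalEnergy_mix_le H x)
    have h2 : gainEnergy H * totalEnergy x ≤ gainEnergy H * (4 * (K + 1) * (n * P)) := by gcongr
    have h3 : totalEnergy z' ≤ P * totalEnergy z' :=
      le_mul_of_one_le_left (totalEnergy_nonneg _) hP
    rw [div_le_iff₀ hρ0, hρ]
    nlinarith
  have hQ2 : Q2 / r ≤ totalEnergy z / 2 + totalEnergy z' / 2 := by
    have h1 : Q2 ≤ 2 * totalEnergy z + 2 * (gainEnergy A * totalEnergy z') := by
      refine (totalEnergy_add_le _ _).trans ?_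
      rw [totalEnergy_neg]
      gcongr
      exact totalEnergy_mix_le A z'
    have h3 := mul_nonneg hCA (totalEnergy_nonneg z)
    have h4 := mul_nonneg hCA (totalEnergy_nonneg z')
    have h5 := totalEnergy_nonneg z
    have h6 := totalEnergy_nonneg z'
    rw [div_le_iff₀ hr0, hr]
    nlinarith
  have hz := totalEnergy_nonneg z
  have hexp : Real.exp (-totalEnergy z) * Real.exp (-totalEnergy z') ≤
      Real.exp (-Q1 / ρ) * Real.exp (-Q2 / r) *
        Real.exp (n * (2 * (K + 1) * gainEnergy H)) := by
    rw [← Real.exp_add, ← Real.exp_add, ← Real.exp_add, Real.exp_le_exp, neg_div, neg_div]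
    linarith
  have hpi := Real.pi_pos
  have hpos : 0 < (Real.pi * ρ)⁻¹ ^ m * (Real.pi * r)⁻¹ ^ m *
      (Real.exp (-Q1 / ρ) * Real.exp (-Q2 / r)) := by positivity
  refine le_of_mul_le_mul_right ?_ hpos
  calc γ ^ (K + 1) * N ^ 2 * ((Real.pi * ρ)⁻¹ ^ m * (Real.pi * r)⁻¹ ^ m *
        (Real.exp (-Q1 / ρ) * Real.exp (-Q2 / r))) = _ := by ring
    _ ≤ _ := hle
    _ = Real.pi⁻¹ ^ m * Real.pi⁻¹ ^ m *
        (Real.exp (-totalEnergy z) * Real.exp (-totalEnergy z')) := by ring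
    _ ≤ Real.pi⁻¹ ^ m * Real.pi⁻¹ ^ m * (Real.exp (-Q1 / ρ) * Real.exp (-Q2 / r) *
        Real.exp (n * (2 * (K + 1) * gainEnergy H))) := by gcongr
    -- Both sides carry the same powers of `π`; what survives is `(ρ * r) ^ m`, the source of `P ^
    -- (n * ∑ i, M i)`.
    _ = ((ρ * r) * (Real.pi * ρ)⁻¹ * (Real.pi * r)⁻¹) ^ m *
        (Real.exp (-Q1 / ρ) * Real.exp (-Q2 / r) *
          Real.exp (n * (2 * (K + 1) * gainEnergy H))) := by
        rw [← mul_pow]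
        congr 2
        field_simp
    _ = _ := by rw [mul_pow, mul_pow]; ring

end MIMOIC

end
-- Generic invertibility of the cross links.
noncomputable section

namespace MIMOIC

section Generic

variable {K : ℕ} {M : Fin K → ℕ} {n : ℕ}

/-- The channel gains as a single square block matrix. -/
def gainMatrix (H : ChannelGains M) : Matrix (Σ i, Fin (M i)) (Σ i, Fin (M i)) ℂ :=
  Matrix.of fun p q => H p.1 q.1 p.2 q.2

lemma mix_apply_eq_mulVec (H : ChannelGains M) (x : ∀ i : Fin K, Fin n → Fin (M i) → ℂ)
    (p : Σ i, Fin (M i)) (t : Fin n) :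
    mix H x p.1 t p.2 = (gainMatrix H *ᵥ fun q => x q.1 t q.2) p := by
  rw [mix_apply, Matrix.mulVec, dotProduct, Fintype.sum_sigma]
  rfl

lemma exists_mix_mix_cross (H : ChannelGains M) (h : (gainMatrix (cross H)).det ≠ 0) :
    ∃ A : ChannelGains M, ∀ (n : ℕ) (x : ∀ i : Fin K, Fin n → Fin (M i) → ℂ),
      mix A (mix (cross H) x) = mix H x := by
  refine ⟨fun i k a b => (gainMatrix H * (gainMatrix (cross H))⁻¹) ⟨i, a⟩ ⟨k, b⟩, fun n x => ?_⟩
  ext i t a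
  have h1 := mix_apply_eq_mulVec
    (fun i k a b => (gainMatrix H * (gainMatrix (cross H))⁻¹) ⟨i, a⟩ ⟨k, b⟩)
    (mix (cross H) x) ⟨i, a⟩ t
  have h2 : gainMatrix (M := M)
      (fun i k a b => (gainMatrix H * (gainMatrix (cross H))⁻¹) ⟨i, a⟩ ⟨k, b⟩) =
      gainMatrix H * (gainMatrix (cross H))⁻¹ := rfl
  simp_rw [mix_apply_eq_mulVec (cross H)] at h1
  rw [h2, ← Matrix.mulVec_mulVec, Matrix.mulVec_mulVec _ (gainMatrix (cross H))⁻¹,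
    Matrix.nonsing_inv_mul _ (isUnit_iff_ne_zero.2 h), Matrix.one_mulVec] at h1
  rw [mix_apply_eq_mulVec H x ⟨i, a⟩ t]
  exact h1

lemma gainMatrix_cross_add_smul (H H₁ : ChannelGains M) (c : ℂ) :
    gainMatrix (cross (H + c • H₁)) = gainMatrix (cross H) + c • gainMatrix (cross H₁) := by
  ext p q
  by_cases h : p.1 = q.1 <;> simp [gainMatrix, cross, h]

/-- Factoring out `Y` leaves the characteristic polynomial of `-(Y⁻¹ * X)`, which is monic and so
has finitely many roots. -/
lemma finite_det_add_smul_eq_zero {ι : Type*} [Fintype ι] [DecidableEq ι] (X Y : Matrix ι ι ℂ)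
    (hY : Y.det ≠ 0) : {c : ℂ | (X + c • Y).det = 0}.Finite := by
  have hsub : {c : ℂ | (X + c • Y).det = 0} ⊆ {c | (-(Y⁻¹ * X)).charpoly.IsRoot c} := by
    intro c hc
    have hfac : X + c • Y = Y * (Matrix.scalar ι c - -(Y⁻¹ * X)) := by
      rw [sub_neg_eq_add, mul_add, Matrix.mul_nonsing_inv_cancel_left _ _ (isUnit_iff_ne_zero.2 hY),
        add_comm, Matrix.scalar_apply, ← Matrix.smul_one_eq_diagonal, Matrix.mul_smul, mul_one]
    have hc' : (X + c • Y).det = 0 := hc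
    rw [hfac, Matrix.det_mul, mul_eq_zero, or_iff_right hY] at hc'
    change Polynomial.eval c _ = 0
    rw [Matrix.eval_charpoly, hc']
  exact (Polynomial.finite_setOfPred_isRoot (Matrix.charpoly_monic _).ne_zero).subset hsub

lemma continuous_det_gainMatrix_cross :
    Continuous fun H : ChannelGains M => (gainMatrix (cross H)).det := by
  refine Continuous.matrix_det (continuous_matrix fun p q => ?_)
  by_cases h : p.1 = q.1
  · simp only [gainMatrix, cross, Matrix.of_apply, h, if_true]
    exact continuous_const
  · simp only [gainMatrix, cross, Matrix.of_apply, h, if_false]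
    fun_prop

instance : (volume : Measure (ChannelGains M)).IsAddHaarMeasure := by
  have h' (i k : Fin K) : (volume : Measure (Fin (M i) → Fin (M k) → ℂ)).IsAddHaarMeasure := by
    have : (volume : Measure (Fin (M k) → ℂ)).IsAddHaarMeasure := by
      rw [volume_pi]
      exact Measure.pi.isAddHaarMeasure _
    rw [volume_pi]
    exact Measure.pi.isAddHaarMeasure _
  have h (i : Fin K) :
      (volume : Measure (∀ k : Fin K, Fin (M i) → Fin (M k) → ℂ)).IsAddHaarMeasure := by
    rw [volume_pi]
    exact Measure.pi.isAddHaarMeasure _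
  rw [volume_pi]
  exact Measure.pi.isAddHaarMeasure _

/-- On every line in direction `H₁` the determinant vanishes at only finitely many points; a Fubini
argument along these lines gives the claim. -/
lemma ae_det_gainMatrix_cross_ne_zero (H₁ : ChannelGains M)
    (h₁ : (gainMatrix (cross H₁)).det ≠ 0) :
    ∀ᵐ H : ChannelGains M, (gainMatrix (cross H)).det ≠ 0 := by
  have hs : MeasurableSet {H : ChannelGains M | (gainMatrix (cross H)).det ≠ 0} :=
    (isOpen_ne_fun continuous_det_gainMatrix_cross continuous_const).measurableSet
  refine ae_mem_of_ae_add_linearMap_mem (LinearMap.toSpanSingleton ℂ (ChannelGains M) H₁)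
    (volume : Measure ℂ) volume hs fun H => ?_
  have hfin := finite_det_add_smul_eq_zero (gainMatrix (cross H)) _ h₁
  filter_upwards [compl_mem_ae_iff.2 (hfin.measure_zero volume)] with c hc
  have : (gainMatrix (cross (H + c • H₁))).det ≠ 0 := by
    rw [gainMatrix_cross_add_smul]
    exact hc
  exact this

/-- A cyclic rotation: positions move up by `b` or down by `a`. -/
lemma exists_perm_shift (a b : ℕ) :
    ∃ f : Equiv.Perm (Fin (a + b)), ∀ x, (f x : ℕ) = x + b ∨ (f x : ℕ) + a = x := by
  refine ⟨finAddFlip.trans (finCongr (add_comm b a)), fun x => ?_⟩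
  induction x using Fin.addCases with
  | left x => left; simp [add_comm]
  | right x => right; simp [add_comm]

/-- List the antennas user by user and rotate. Every position moves by `M 0` or `M 1 + M 2`, both at
least the length of any block, so it leaves its block. -/
lemma exists_perm_ne_fst (M : Fin 3 → ℕ) (h₁₂ : M 1 ≤ M 0) (h₂₃ : M 2 ≤ M 1)
    (hdom : M 0 ≤ M 1 + M 2) :
    ∃ σ : Equiv.Perm (Σ i, Fin (M i)), ∀ p, (σ p).1 ≠ p.1 := by
  have hT : ∑ i, M i = M 0 + (M 1 + M 2) := by rw [Fin.sum_univ_three, add_assoc]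
  obtain ⟨f, hf⟩ := exists_perm_shift (M 0) (M 1 + M 2)
  let e : (Σ i, Fin (M i)) ≃ Fin (M 0 + (M 1 + M 2)) := finSigmaFinEquiv.trans (finCongr hT)
  refine ⟨(e.trans f).trans e.symm, ?_⟩
  rintro p hp
  obtain ⟨q, hq⟩ : ∃ q, q = e.symm (f (e p)) := ⟨_, rfl⟩
  have hp' : q.1 = p.1 := by rw [hq]; exact hp
  have hqe : e q = f (e p) := by rw [hq, Equiv.apply_symm_apply]
  have hfp := hf (e p)
  rw [← hqe] at hfp
  obtain ⟨i, a⟩ := p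
  obtain ⟨j, b⟩ := q
  obtain rfl : j = i := hp'
  have hea : (e ⟨j, a⟩ : ℕ) = ∑ l : Fin j, M (Fin.castLE j.2.le l) + a :=
    finSigmaFinEquiv_apply ⟨j, a⟩
  have heb : (e ⟨j, b⟩ : ℕ) = ∑ l : Fin j, M (Fin.castLE j.2.le l) + b :=
    finSigmaFinEquiv_apply ⟨j, b⟩
  rw [hea, heb] at hfp
  have ha := a.2
  have hb := b.2
  have hj : M j ≤ M 0 := by
    fin_cases j
    · exact le_rfl
    · exact h₁₂
    · exact h₂₃.trans h₁₂
  omega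

lemma exists_det_gainMatrix_cross_ne_zero (σ : Equiv.Perm (Σ i, Fin (M i)))
    (hσ : ∀ p, (σ p).1 ≠ p.1) : ∃ H : ChannelGains M, (gainMatrix (cross H)).det ≠ 0 := by
  refine ⟨fun i k a b => σ.permMatrix ℂ ⟨i, a⟩ ⟨k, b⟩, ?_⟩
  have h : gainMatrix (cross (M := M) fun i k a b => σ.permMatrix ℂ ⟨i, a⟩ ⟨k, b⟩) =
      σ.permMatrix ℂ := by
    ext p q
    by_cases hpq : p.1 = q.1
    · have hne : σ p ≠ q := by
        rintro rfl
        exact hσ p hpq.symm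
      simp [gainMatrix, cross, hpq, PEquiv.toMatrix_apply, hne]
    · simp [gainMatrix, cross, hpq]
  rw [h, Matrix.det_permutation]
  exact_mod_cast (Equiv.Perm.sign σ).ne_zero

end Generic

/-! ### From the one-shot bound to degrees of freedom. -/

section DegreesOfFreedom

variable {K : ℕ} {M : Fin K → ℕ}

lemma Code.two_mul_sum_rate_le {n : ℕ} {R : Fin K → ℝ≥0} {P : ℝ} (H A : ChannelGains M)
    (hA : ∀ x : ∀ i : Fin K, Fin n → Fin (M i) → ℂ, mix A (mix (cross H) x) = mix H x)
    (C : Code M n R P) (hn : 0 < n) (hP : 1 ≤ P) (herr : C.errorProb H ≤ 1 / 8) :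
    Real.log ((1 / (4 * (K + 1)) : ℝ) ^ (K + 1)) + 2 * (n * (∑ i, (R i : ℝ)) * Real.log 2) ≤
      n * (∑ i, M i : ℕ) * (Real.log P + Real.log (4 * (4 * (1 + gainEnergy A)))) +
        n * (2 * (K + 1) * gainEnergy H) := by
  have hCA := gainEnergy_nonneg A
  set V : Fin K → Type := fun i => Fin (2 ^ ⌈(n : ℝ) * (R i : ℝ)⌉₊) with hV
  have hN0 : (0 : ℝ) < Fintype.card (∀ i, V i) := Nat.cast_pos.2 Fintype.card_pos
  have hpow (i : Fin K) : ∑ v : V i, energy (C.enc i v) ≤ Fintype.card (V i) * (n * P) := by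
    have h := C.power i
    rw [div_le_iff₀ (by positivity)] at h
    refine h.trans_eq ?_
    simp [hV]
    ring
  have herr' : ∑ w : ∀ i, V i,
      noiseLaw M n {z | ∃ i, C.dec i ((mix H (sent C.enc w) + z) i) ≠ w i} ≤
      ENNReal.ofReal (Fintype.card (∀ i, V i) / 8) := by
    rw [Code.errorProb, div_le_iff₀ hN0] at herr
    calc _ = ∑ w : ∀ i, V i, ENNReal.ofReal
          ((noiseLaw M n).real {z | ∃ i, C.dec i (C.output H w z i) ≠ w i}) :=
          Finset.sum_congr rfl fun w _ => (ofReal_measureReal).symm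
      _ = ENNReal.ofReal (∑ w : ∀ i, V i,
          (noiseLaw M n).real {z | ∃ i, C.dec i (C.output H w z i) ≠ w i}) :=
          (ENNReal.ofReal_sum_of_nonneg fun _ _ => measureReal_nonneg).symm
      _ ≤ _ := by
          refine ENNReal.ofReal_le_ofReal (herr.trans_eq ?_)
          ring
  have key := card_sq_le (V := V) H A hA C.enc C.dec C.measurable_dec hP hn hpow herr'
  have hN : n * (∑ i, (R i : ℝ)) * Real.log 2 ≤ Real.log (Fintype.card (∀ i, V i)) := by
    rw [Fintype.card_pi, Nat.cast_prod, Real.log_prod (fun i _ => by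
      exact Nat.cast_ne_zero.2 Fintype.card_ne_zero), Finset.mul_sum, Finset.sum_mul]
    refine Finset.sum_le_sum fun i _ => ?_
    simp only [hV, Fintype.card_fin, Nat.cast_pow, Nat.cast_ofNat, Real.log_pow]
    have := Real.log_nonneg one_le_two
    gcongr
    exact Nat.le_ceil _
  have hlog := Real.log_le_log (by positivity) key
  rw [Real.log_mul (by positivity) (by positivity), Real.log_mul (by positivity) (by positivity),
    Real.log_exp, Real.log_pow _ 2,
    Real.log_pow _ (n * ∑ i, M i), show 4 * P * (4 * (1 + gainEnergy A)) =
      P * (4 * (4 * (1 + gainEnergy A))) by ring,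
    Real.log_mul (by positivity) (by positivity)] at hlog
  push_cast at hlog ⊢
  linarith

/-- Divide the one-shot bound by `n` and let `n → ∞`: the constant from `γ` vanishes, and `c`
depends on `H` and `A` but not on `P` or `R`. -/
lemma exists_two_mul_sum_rate_le (H A : ChannelGains M)
    (hA : ∀ (n : ℕ) (x : ∀ i : Fin K, Fin n → Fin (M i) → ℂ),
      mix A (mix (cross H) x) = mix H x) :
    ∃ c : ℝ, ∀ (P : ℝ) (R : Fin K → ℝ≥0), 1 ≤ P → Achievable H P R →
      2 * ∑ i, (R i : ℝ) ≤ (∑ i, M i : ℕ) * Real.logb 2 P + c := by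
  set L := Real.log (4 * (4 * (1 + gainEnergy A)))
  set G := 2 * (K + 1) * gainEnergy H
  set T : ℝ := ((∑ i, M i : ℕ) : ℝ)
  set D := Real.log ((1 / (4 * (K + 1)) : ℝ) ^ (K + 1))
  refine ⟨(T * L + G) / Real.log 2, fun P R hP ⟨C, hC⟩ => ?_⟩
  have hlog2 : 0 < Real.log 2 := Real.log_pos one_lt_two
  have hlim : Tendsto (fun n : ℕ => T * (Real.log P + L) + G - D / n) atTop
      (𝓝 (T * (Real.log P + L) + G - 0)) :=
    tendsto_const_nhds.sub (tendsto_const_div_atTop_nhds_zero_nat D)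
  have hle : 2 * (∑ i, (R i : ℝ)) * Real.log 2 ≤ T * (Real.log P + L) + G - 0 := by
    refine ge_of_tendsto hlim ?_
    filter_upwards [hC.eventually_le_const (by norm_num : (0 : ℝ) < 1 / 8), eventually_gt_atTop 0]
      with n hn hn0
    have h := (C n).two_mul_sum_rate_le H A (hA n) hn0 hP hn
    have hn' : (0 : ℝ) < n := Nat.cast_pos.2 hn0
    rw [le_sub_iff_add_le, ← le_sub_iff_add_le', div_le_iff₀ hn']
    linarith
  rw [Real.logb, ← mul_div_assoc, ← add_div, le_div_iff₀ hlog2]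
  linarith

/-- If the matrix of the cross links is invertible, the sum degrees of freedom are at most half
the number of antennas. -/
theorem sumDoF_le (H : ChannelGains M) (h : (gainMatrix (cross H)).det ≠ 0) :
    sumDoF H ≤ ((∑ i, M i : ℕ) : ℝ≥0∞) / 2 := by
  obtain ⟨A, hA⟩ := exists_mix_mix_cross H h
  obtain ⟨c, hc⟩ := exists_two_mul_sum_rate_le H A hA
  refine sSup_le ?_
  rintro _ ⟨R, d, hach, hlim, rfl⟩
  set T : ℝ := ((∑ i, M i : ℕ) : ℝ) with hT
  -- The `0` is the limit of `c / logb 2 P`.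
  have hT2 : ((∑ i, M i : ℕ) : ℝ≥0∞) / 2 = ENNReal.ofReal ((T + 0) / 2) := by
    rw [add_zero, ENNReal.ofReal_div_of_pos two_pos, hT, ENNReal.ofReal_natCast,
      ENNReal.ofReal_ofNat]
  have hlogb : Tendsto (fun P : ℝ => Real.logb 2 P) atTop atTop :=
    Real.tendsto_logb_atTop one_lt_two
  have hup : Tendsto (fun P : ℝ => ENNReal.ofReal ((T + c / Real.logb 2 P) / 2)) atTop
      (𝓝 (ENNReal.ofReal ((T + 0) / 2))) :=
    ENNReal.tendsto_ofReal ((tendsto_const_nhds.add (tendsto_const_nhds.div_atTop hlogb)).div_const 2)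
  rw [hT2]
  refine le_of_tendsto_of_tendsto (tendsto_finsetSum _ fun i _ => hlim i) hup ?_
  filter_upwards [eventually_gt_atTop 1] with P hP
  have hl : 0 < Real.logb 2 P := Real.logb_pos one_lt_two hP
  rw [← ENNReal.ofReal_sum_of_nonneg fun i _ => by positivity]
  refine ENNReal.ofReal_le_ofReal ?_
  have h2 := hc P (R P) hP.le (hach P (by linarith))
  rw [← Finset.sum_div, le_div_iff₀ two_pos, div_mul_eq_mul_div, div_le_iff₀ hl, add_mul,
    div_mul_cancel₀ _ hl.ne']
  linarith

end DegreesOfFreedom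

end MIMOIC

end

theorem mainTheorem2 (M : Fin 3 → ℕ) (h₁₂ : M 1 ≤ M 0) (h₂₃ : M 2 ≤ M 1)
    (hdom : M 0 < M 1 + M 2) :
    ∀ᵐ H : MIMOIC.ChannelGains M,
      MIMOIC.sumDoF H ≤ ((M 0 + M 1 + M 2 : ℕ) : ENNReal) / 2 := by
  obtain ⟨σ, hσ⟩ := MIMOIC.exists_perm_ne_fst M h₁₂ h₂₃ hdom.le
  obtain ⟨H₁, h₁⟩ := MIMOIC.exists_det_gainMatrix_cross_ne_zero σ hσ
  filter_upwards [MIMOIC.ae_det_gainMatrix_cross_ne_zero H₁ h₁] with H hH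
  rw [← Fin.sum_univ_three]
  exact MIMOIC.sumDoF_le H hH
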